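/- For a proper coloring $c$ of a finite connected graph $G$ that uses all the colors $1,\dots,k$, with color classes $V_1,\dots,V_k$, the color code of a vertex $v$ is $(d(v,V_1),\dots,d(v,V_k))$, where $d(v,S)=\min\{d(v,x) : x\in S\}$. The coloring is called locating if distinct vertices have distinct color codes, and the locating chromatic number $\chi_L(G)$ is the minimum number of colors in a locating coloring of $G$. Let $m\ge 2$ and $n\ge 3$ be integers with $m\le n$, let $m_0:=\max\{k\in\mathbb{N} : k(k-1)-1\le n\}$, and let $K_m\square K_n$ be the Cartesian product of the complete graphs on $m$ and $n$ vertices. (a) If $m\le m_0-1$, then $\chi_L(K_m\square K_n)=n+1$. (b) If $m_0+1\le m\le \frac n2$, then $\chi_L(K_m\square K_n)=n+2$. -/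

import Mathlib

namespace LocatingColoring

universe u

/-- The distance `d(v, S) = min {d(v, x) | x ∈ S}` from a vertex to a set of vertices
(`⊤` if `S` is empty or cannot be reached from `v`). -/
noncomputable def distToSet {V : Type u} (G : SimpleGraph V) (v : V) (S : Set V) : ℕ∞ :=
  ⨅ x ∈ S, G.edist v x

/-- The color code of `v`: the tuple of the distances from `v` to the color classes. -/
noncomputable def colorCode {V : Type u} {G : SimpleGraph V} {k : ℕ} (c : G.Coloring (Fin k))
    (v : V) : Fin k → ℕ∞ :=
  fun i => distToSet G v (c.colorClass i)

/-- A proper coloring by `k` colors is a locating `k`-coloring if all `k` colors are used and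
distinct vertices have distinct color codes. -/
def IsLocating {V : Type u} {G : SimpleGraph V} {k : ℕ} (c : G.Coloring (Fin k)) : Prop :=
  Function.Surjective c ∧ ∀ u v : V, u ≠ v → colorCode c u ≠ colorCode c v

/-- The locating chromatic number: the minimum number of colors in a locating coloring
(`⊤` if there is none, which does not happen for finite graphs). -/
noncomputable def locatingChromaticNumber {V : Type u} (G : SimpleGraph V) : ℕ∞ :=
  ⨅ k ∈ {k : ℕ | ∃ c : G.Coloring (Fin k), IsLocating c}, (k : ℕ∞)

end LocatingColoring

namespace LocatingColoring

open SimpleGraph Finset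

/-! The graph has diameter at most two, so a code records only a cell's color and which colors meet
its row or column. This turns colorings into arrays (`exists_isLocating_iff`).

With `n` colors every cell sees everything, so at least `n + 1` are needed. With `n + 1` colors row
`i` misses exactly one color `r i`, and a cell of that row is full (sees all colors) exactly when `r
i` occurs in its column. Full cells in different rows must carry different colors. If `2 * m ≤ n`
the `r i` are distinct, so each row has `m - 1` full cells and `m * (m - 1) ≤ n + 1`
(`mul_pred_le`), which fails for `m > m₀`; a cyclic array then does it with `n + 2` colors.

For `m < m₀` there is room to reserve disjoint sets of colors for the full cells of each row; a
Hall-type completion realizes this (`exists_locatingArray`). -/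

theorem distToSet_le_iff {V : Type*} {G : SimpleGraph V} {v : V} {S : Set V} {d : ℕ} :
    distToSet G v S ≤ d ↔ ∃ x ∈ S, G.edist v x ≤ d := by
  constructor
  · intro h
    by_contra! hc
    have h1 : ((d + 1 : ℕ) : ℕ∞) ≤ distToSet G v S := by
      refine le_iInf₂ fun x hx => ?_
      have := Order.add_one_le_of_lt (hc x hx)
      exact_mod_cast this
    have h2 := h1.trans h
    norm_cast at h2
    omega
  · rintro ⟨x, hx, h⟩
    exact (iInf₂_le x hx).trans h

theorem colorCode_le_iff {V : Type*} {G : SimpleGraph V} {k : ℕ} {c : G.Coloring (Fin k)}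
    {v : V} {s : Fin k} {d : ℕ} :
    colorCode c v s ≤ d ↔ ∃ x, c x = s ∧ G.edist v x ≤ d :=
  distToSet_le_iff

theorem colorCode_eq_zero_iff {V : Type*} {G : SimpleGraph V} {k : ℕ} {c : G.Coloring (Fin k)}
    {v : V} {s : Fin k} : colorCode c v s = 0 ↔ c v = s := by
  have h := colorCode_le_iff (c := c) (v := v) (s := s) (d := 0)
  rw [Nat.cast_zero, nonpos_iff_eq_zero] at h
  rw [h]
  constructor
  · rintro ⟨x, hx, h0⟩
    rw [nonpos_iff_eq_zero, SimpleGraph.edist_eq_zero_iff] at h0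
    rw [h0, hx]
  · intro hv
    exact ⟨v, hv, by simp⟩

/-! ### Distances and color codes in the product -/

/-- The Cartesian product of two complete graphs. -/
abbrev rook (m n : ℕ) : SimpleGraph (Fin m × Fin n) :=
  completeGraph (Fin m) □ completeGraph (Fin n)

theorem rook_adj {m n : ℕ} {u v : Fin m × Fin n} :
    (rook m n).Adj u v ↔ (u.1 ≠ v.1 ∧ u.2 = v.2) ∨ (u.2 ≠ v.2 ∧ u.1 = v.1) := by
  simp [rook, SimpleGraph.boxProd_adj]

theorem rook_edist_le_one {m n : ℕ} {u v : Fin m × Fin n} :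
    (rook m n).edist u v ≤ (1 : ℕ) ↔ u.1 = v.1 ∨ u.2 = v.2 := by
  constructor
  · intro h
    rcases Order.le_one_iff.1 (by exact_mod_cast h) with h | h
    · rw [SimpleGraph.edist_eq_zero_iff] at h
      simp [h]
    · rw [SimpleGraph.edist_eq_one_iff_adj, rook_adj] at h
      tauto
  · intro h
    by_cases huv : u = v
    · simp [huv]
    · have : (rook m n).Adj u v := by
        rw [rook_adj]
        rw [Prod.ext_iff] at huv
        tauto
      rw [(SimpleGraph.edist_eq_one_iff_adj).2 this]
      simp

theorem rook_edist_le_two {m n : ℕ} (u v : Fin m × Fin n) :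
    (rook m n).edist u v ≤ (2 : ℕ) := by
  have h1 : (rook m n).edist u (u.1, v.2) ≤ (1 : ℕ) := rook_edist_le_one.2 (Or.inl rfl)
  have h2 : (rook m n).edist (u.1, v.2) v ≤ (1 : ℕ) := rook_edist_le_one.2 (Or.inr rfl)
  calc _ ≤ _ := SimpleGraph.edist_triangle (v := (u.1, v.2))
    _ ≤ ((1 : ℕ) : ℕ∞) + (1 : ℕ) := add_le_add h1 h2
    _ = (2 : ℕ) := by norm_num

/-- The symbol `s` occurs in row `i` or in column `j` of the array `L`. -/
def Near {ι κ σ : Type*} (L : ι → κ → σ) (i : ι) (j : κ) (s : σ) : Prop :=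
  (∃ j', L i j' = s) ∨ ∃ i', L i' j = s

theorem colorCode_le_one_iff {m n k : ℕ} {c : (rook m n).Coloring (Fin k)}
    {v : Fin m × Fin n} {s : Fin k} :
    colorCode c v s ≤ (1 : ℕ) ↔ Near (fun i j => c (i, j)) v.1 v.2 s := by
  rw [colorCode_le_iff]
  constructor
  · rintro ⟨⟨a, b⟩, hx, h⟩
    rcases rook_edist_le_one.1 h with h | h
    · exact Or.inl ⟨b, by simpa [h] using hx⟩
    · exact Or.inr ⟨a, by simpa [h] using hx⟩
  · rintro (⟨b, h⟩ | ⟨a, h⟩)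
    · exact ⟨_, h, rook_edist_le_one.2 (Or.inl rfl)⟩
    · exact ⟨_, h, rook_edist_le_one.2 (Or.inr rfl)⟩

/-- Every color is used, so each coordinate is 0, 1 or 2; the own color fixes the zeros and `Near`
fixes the values at most 1. -/
theorem colorCode_eq_iff {m n k : ℕ} {c : (rook m n).Coloring (Fin k)}
    (hc : Function.Surjective c) {u v : Fin m × Fin n} :
    colorCode c u = colorCode c v ↔ c u = c v ∧
      ∀ s, Near (fun i j => c (i, j)) u.1 u.2 s ↔ Near (fun i j => c (i, j)) v.1 v.2 s := by
  constructor
  · intro h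
    refine ⟨?_, fun s => ?_⟩
    · have := colorCode_eq_zero_iff (c := c) (v := u) (s := c u)
      rw [h, colorCode_eq_zero_iff] at this
      exact (this.2 rfl).symm
    · rw [← colorCode_le_one_iff, ← colorCode_le_one_iff, h]
  · rintro ⟨h0, h1⟩
    funext s
    have two (w) : colorCode c w s ≤ (2 : ℕ) := by
      obtain ⟨x, hx⟩ := hc s
      exact colorCode_le_iff.2 ⟨x, hx, rook_edist_le_two _ _⟩
    have e0 : colorCode c u s = 0 ↔ colorCode c v s = 0 := by
      rw [colorCode_eq_zero_iff, colorCode_eq_zero_iff, h0]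
    have e1 : colorCode c u s ≤ (1 : ℕ) ↔ colorCode c v s ≤ (1 : ℕ) := by
      rw [colorCode_le_one_iff, colorCode_le_one_iff, h1]
    have hu := two u
    have hv := two v
    generalize colorCode c u s = a at *
    generalize colorCode c v s = b at *
    lift a to ℕ using ne_top_of_le_ne_top (ENat.natCast_ne_top _) hu
    lift b to ℕ using ne_top_of_le_ne_top (ENat.natCast_ne_top _) hv
    norm_cast at *
    omega

/-- An array describing a locating coloring of the product of two complete graphs. -/
structure LocatingArray {ι κ σ : Type*} (L : ι → κ → σ) : Prop where
  row : ∀ i, Function.Injective (L i)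
  col : ∀ i i' j, L i j = L i' j → i = i'
  surj : ∀ s, ∃ i j, L i j = s
  sep : ∀ i i' j j', i ≠ i' → L i j = L i' j' → ¬ ∀ s, Near L i j s ↔ Near L i' j' s

theorem exists_isLocating_iff {m n k : ℕ} :
    (∃ c : (rook m n).Coloring (Fin k), IsLocating c) ↔
      ∃ L : Fin m → Fin n → Fin k, LocatingArray L := by
  constructor
  · rintro ⟨c, hs, hl⟩
    refine ⟨fun i j => c (i, j), ?_, ?_, ?_, ?_⟩
    · intro i j j' h
      by_contra hne
      exact c.valid (v := (i, j)) (w := (i, j')) (rook_adj.2 (Or.inr ⟨hne, rfl⟩)) h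
    · intro i i' j h
      by_contra hne
      exact c.valid (v := (i, j)) (w := (i', j)) (rook_adj.2 (Or.inl ⟨hne, rfl⟩)) h
    · intro s
      obtain ⟨⟨i, j⟩, h⟩ := hs s
      exact ⟨i, j, h⟩
    · intro i i' j j' hne h hn
      exact hl (i, j) (i', j') (by simp [hne]) ((colorCode_eq_iff hs).2 ⟨h, hn⟩)
  · rintro ⟨L, hL⟩
    let c : (rook m n).Coloring (Fin k) := SimpleGraph.Coloring.mk (fun p => L p.1 p.2) (by
      rintro ⟨i, j⟩ ⟨i', j'⟩ h heq
      rcases rook_adj.1 h with ⟨h1, h2⟩ | ⟨h1, h2⟩ <;> dsimp only at h1 h2 heq <;> subst h2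
      · exact h1 (hL.col _ _ _ heq)
      · exact h1 (hL.row _ heq))
    have hs : Function.Surjective c := fun s => by
      obtain ⟨i, j, h⟩ := hL.surj s
      exact ⟨(i, j), h⟩
    refine ⟨c, hs, ?_⟩
    rintro ⟨i, j⟩ ⟨i', j'⟩ hne heq
    obtain ⟨h0, h1⟩ := (colorCode_eq_iff hs).1 heq
    have h0' : L i j = L i' j' := h0
    by_cases hi : i = i'
    · subst hi
      exact hne (by rw [hL.row _ h0'])
    · exact hL.sep i i' j j' hi h0 h1

/-! ### Lower bounds -/

theorem LocatingArray.lt_card {m n k : ℕ} (hm : 2 ≤ m) (hn : 1 ≤ n)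
    {L : Fin m → Fin n → Fin k} (hL : LocatingArray L) : n + 1 ≤ k := by
  have hle : n ≤ k := by simpa using Fintype.card_le_of_injective _ (hL.row ⟨0, by omega⟩)
  rcases hle.eq_or_lt with rfl | h
  · exfalso
    have hsurj (i) : Function.Surjective (L i) := Finite.surjective_of_injective (hL.row i)
    obtain ⟨j, hj⟩ := hsurj ⟨1, by omega⟩ (L ⟨0, by omega⟩ ⟨0, hn⟩)
    refine hL.sep ⟨0, by omega⟩ ⟨1, by omega⟩ ⟨0, hn⟩ j (by simp) hj.symm fun s => ?_
    exact iff_of_true (Or.inl (hsurj _ s)) (Or.inl (hsurj _ s))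
  · exact h

theorem exists_missing_symbol {n : ℕ} {f : Fin n → Fin (n + 1)} (hf : Function.Injective f) :
    ∃ r, (∀ j, f j ≠ r) ∧ ∀ s, s ≠ r → ∃ j, f j = s := by
  have hcard : (univ \ univ.image f).card = 1 := by
    rw [card_sdiff_of_subset (subset_univ _), card_image_of_injective _ hf]
    simp
  obtain ⟨r, hr⟩ := card_eq_one.1 hcard
  have key (s) : s = r ↔ ∀ j, f j ≠ s := by
    rw [← mem_singleton, ← hr]
    simp
  refine ⟨r, (key r).1 rfl, fun s hs => ?_⟩
  by_contra! h
  exact hs ((key s).2 h)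

theorem LocatingArray.mul_pred_le {m n : ℕ} (hmn : 2 * m ≤ n) (hn : 1 ≤ n)
    {L : Fin m → Fin n → Fin (n + 1)} (hL : LocatingArray L) : m * (m - 1) ≤ n + 1 := by
  classical
  choose r hr hr' using fun i => exists_missing_symbol (hL.row i)
  have full {i j} (h : ∃ i', L i' j = r i) (s) : Near L i j s := by
    by_cases hs : s = r i
    · exact Or.inr (hs ▸ h)
    · exact Or.inl (hr' i s hs)
  have notfull {i j} (h : ¬ ∃ i', L i' j = r i) (s) : Near L i j s ↔ s ≠ r i := by
    constructor
    · rintro (⟨j', h'⟩ | ⟨i', h'⟩) rfl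
      · exact hr _ _ h'
      · exact h ⟨_, h'⟩
    · exact fun hs => Or.inl (hr' i s hs)
  -- If rows `a` and `b` missed the same symbol, each other symbol would sit in a full cell of one
  -- of them. A row has at most `m - 1` full cells, so `n ≤ 2 * (m - 1)`, contradicting `2 * m ≤ n`.
  have rinj : Function.Injective r := by
    intro a b hab
    by_contra hne
    let F : Finset (Fin n) := univ.filter fun j => ∃ i', L i' j = r a
    have hcover : univ.erase (r a) ⊆ F.image (L a) ∪ F.image (L b) := by
      intro s hs
      have hs' : s ≠ r a := (mem_erase.1 hs).1
      obtain ⟨j, hj⟩ := hr' a s hs'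
      obtain ⟨j', hj'⟩ := hr' b s (hab ▸ hs')
      by_contra hcon
      have h1 : ¬ ∃ i', L i' j = r a := fun h => hcon <|
        mem_union_left _ (mem_image.2 ⟨j, by simpa [F] using h, hj⟩)
      have h2 : ¬ ∃ i', L i' j' = r b := fun h => hcon <|
        mem_union_right _ (mem_image.2 ⟨j', by simpa [F, hab] using h, hj'⟩)
      exact hL.sep a b j j' hne (hj.trans hj'.symm) fun t => by
        rw [notfull h1, notfull h2, hab]
    have hF : F.card ≤ m - 1 := by
      have : Nonempty (Fin m) := ⟨a⟩
      choose! g hg using fun j (hj : j ∈ F) => (mem_filter.1 hj).2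
      have := card_le_card_of_injOn (s := F) (t := univ.erase a) g
        (fun j hj => mem_erase.2 ⟨fun h => hr a j (h ▸ hg j hj), mem_univ _⟩) (by
          intro j hj j' hj' h
          have e1 := hg j hj
          have e2 := hg j' hj'
          rw [← h] at e2
          exact hL.row _ (e1.trans e2.symm))
      simpa [card_erase_of_mem] using this
    have hpos := a.pos
    have := card_le_card hcover
    have h2 := this.trans (card_union_le _ _)
    have h3 := card_image_le (s := F) (f := L a)
    have h4 := card_image_le (s := F) (f := L b)
    rw [card_erase_of_mem (mem_univ _)] at h2
    simp only [card_univ, Fintype.card_fin] at h2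
    omega
  have hpos (p : Fin m × Fin m) : ∃ j, p.1 ≠ p.2 → L p.2 j = r p.1 := by
    by_cases h : p.1 = p.2
    · exact ⟨⟨0, hn⟩, fun h' => (h' h).elim⟩
    · obtain ⟨j, hj⟩ := hr' p.2 (r p.1) (fun h' => h (rinj h'))
      exact ⟨j, fun _ => hj⟩
  choose pos hpos using hpos
  -- For `a ≠ b`, the cell of row `a` in the column where row `b` has `r a` is full; these `m * (m -
  -- 1)` cells carry distinct symbols.
  have := card_le_card_of_injOn (s := (univ : Finset (Fin m)).offDiag)
    (t := (univ : Finset (Fin (n + 1)))) (fun p => L p.1 (pos p)) (by simp) (by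
      rintro ⟨a, b⟩ hp ⟨a', b'⟩ hq h
      have hab : a ≠ b := by simpa using hp
      have hab' : a' ≠ b' := by simpa using hq
      have e1 := hpos (a, b) hab
      have e2 := hpos (a', b') hab'
      dsimp only at h e1 e2
      by_cases haa : a = a'
      · subst haa
        have hj := hL.row _ h
        rw [← hj] at e2
        rw [hL.col _ _ _ (e1.trans e2.symm)]
      · exact (hL.sep _ _ _ _ haa h fun s =>
          iff_of_true (full ⟨b, e1⟩ s) (full ⟨b', e2⟩ s)).elim)
  rw [offDiag_card] at this
  simp only [card_univ, Fintype.card_fin] at this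
  rwa [Nat.mul_sub_one]

/-! ### Cyclic array with `n + 2` symbols -/

/-- The cyclic array whose row `i` omits exactly the symbols `2 * i` and `2 * i + 1`. -/
def cyclicArray (m n : ℕ) (hmn : 2 * m ≤ n) (i : Fin m) (j : Fin n) : Fin (n + 2) :=
  if h : 2 * (i : ℕ) + 2 + j < n + 2 then ⟨2 * i + 2 + j, h⟩ else ⟨2 * i + j - n, by omega⟩

theorem cyclicArray_eq_iff {m n : ℕ} (hmn : 2 * m ≤ n) (i : Fin m) (j : Fin n) (s : Fin (n + 2)) :
    cyclicArray m n hmn i j = s ↔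
      2 * (i : ℕ) + 2 + j = s ∨ 2 * (i : ℕ) + j = s + n := by
  unfold cyclicArray
  split_ifs with h <;> rw [Fin.ext_iff] <;> dsimp only <;> omega

theorem cyclicArray_row {m n : ℕ} (hmn : 2 * m ≤ n) (i : Fin m) (s : Fin (n + 2))
    (h0 : (s : ℕ) ≠ 2 * i) (h1 : (s : ℕ) ≠ 2 * i + 1) : ∃ j, cyclicArray m n hmn i j = s := by
  simp only [cyclicArray_eq_iff]
  by_cases h : (s : ℕ) < 2 * i
  · exact ⟨⟨s + n - 2 * i, by omega⟩, Or.inr (by dsimp only; omega)⟩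
  · exact ⟨⟨s - 2 * i - 2, by omega⟩, Or.inl (by dsimp only; omega)⟩

theorem locatingArray_cyclicArray {m n : ℕ} (hm : 2 ≤ m) (hmn : 2 * m ≤ n) :
    LocatingArray (cyclicArray m n hmn) where
  row i j j' h := by
    rw [cyclicArray_eq_iff] at h
    have := (cyclicArray_eq_iff hmn i j' _).1 rfl
    omega
  col i i' j h := by
    rw [cyclicArray_eq_iff] at h
    have := (cyclicArray_eq_iff hmn i' j _).1 rfl
    omega
  surj s := by
    by_cases h : (s : ℕ) < 2
    · exact ⟨⟨1, by omega⟩, cyclicArray_row hmn _ s (by dsimp only; omega) (by dsimp only; omega)⟩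
    · exact ⟨⟨0, by omega⟩, cyclicArray_row hmn _ s (by dsimp only; omega) (by dsimp only; omega)⟩
  sep i i' j j' hne _ h := by
    -- Row `i'` contains both symbols missing from row `i`, so column `j` would have to contain
    -- both. By parity exactly one of the two arises by wrapping around; wrapping forces `j > 2 * i
    -- + 1`, not wrapping `j < 2 * i`.
    have h0 := (h ⟨2 * i, by omega⟩).2
      (Or.inl (cyclicArray_row hmn i' _ (by dsimp only; omega) (by dsimp only; omega)))
    have h1 := (h ⟨2 * i + 1, by omega⟩).2
      (Or.inl (cyclicArray_row hmn i' _ (by dsimp only; omega) (by dsimp only; omega)))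
    simp only [Near, cyclicArray_eq_iff] at h0 h1
    rcases h0 with ⟨a, h0⟩ | ⟨a, h0⟩
    · omega
    rcases h1 with ⟨b, h1⟩ | ⟨b, h1⟩ <;> omega

/-! ### Completing partial Latin rectangles -/

/-- Hall's theorem for one row: an injective partial row extends to a full row that avoids a
sparse set of forbidden cells outside the prescribed part. -/
theorem exists_injective_extension {κ : Type*} [Fintype κ] [DecidableEq κ] {t : ℕ}
    (A : Finset κ) (f : κ → κ) (hf : Set.InjOn f A) (F : κ → κ → Prop)
    (hcol : ∀ j, {s | F j s}.ncard ≤ t) (hsym : ∀ s, {j | F j s}.ncard ≤ t)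
    (hA : A.card + 2 * t ≤ Fintype.card κ) :
    ∃ g : κ → κ, Function.Injective g ∧ (∀ j ∈ A, g j = f j) ∧ ∀ j ∉ A, ¬ F j (g j) := by
  classical
  let B : Finset κ := univ \ A.image f
  have hB : B.card + A.card = Fintype.card κ := by
    rw [← card_image_of_injOn hf, card_sdiff_add_card_eq_card (subset_univ _), card_univ]
  let T : {j // j ∉ A} → Finset κ := fun j => B.filter fun s => ¬ F j s
  have hall : ∀ X : Finset {j // j ∉ A}, X.card ≤ (X.biUnion T).card := by
    intro X
    rcases X.eq_empty_or_nonempty with rfl | ⟨j, hj⟩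
    · simp
    -- For small `X` one cell already has `|B| - t ≥ t` candidates. For `|X| > t` no symbol is
    -- forbidden on all of `X`, so the union is all of `B`, which has as many elements as there are
    -- free cells.
    by_cases hX : X.card ≤ t
    · have h1 : T j ⊆ X.biUnion T := subset_biUnion_of_mem T hj
      have h2 := card_le_card h1
      have h3 := card_filter_add_card_filter_not (s := B) (fun s => F j s)
      have h4 : (B.filter fun s => F j s).card ≤ t := by
        refine le_trans ?_ (hcol j)
        rw [← Set.ncard_coe_finset]
        exact Set.ncard_le_ncard (by intro s hs; simp at hs; exact hs.2) (Set.toFinite _)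
      have h5 : (T j).card = (B.filter fun s => ¬ F j s).card := rfl
      omega
    · have h1 : B ⊆ X.biUnion T := by
        intro s hs
        by_contra hcon
        have hF : ∀ j ∈ X, F j s := by
          intro j hj
          by_contra hFj
          exact hcon (mem_biUnion.2 ⟨j, hj, mem_filter.2 ⟨hs, hFj⟩⟩)
        have h2 : (X.map (Function.Embedding.subtype _)).card ≤ t := by
          refine le_trans ?_ (hsym s)
          rw [← Set.ncard_coe_finset]
          refine Set.ncard_le_ncard ?_ (Set.toFinite _)
          intro j hj
          obtain ⟨x, hx, rfl⟩ := mem_map.1 (mem_coe.1 hj)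
          exact hF x hx
        rw [card_map] at h2
        exact hX h2
      have h2 := card_le_card h1
      have h3 : X.card ≤ Fintype.card {j // j ∉ A} := card_le_univ X
      rw [Fintype.card_subtype_compl] at h3
      simp only [Fintype.card_coe] at h3
      omega
  obtain ⟨g, ginj, hg⟩ := (Finset.all_card_le_biUnion_card_iff_exists_injective T).1 hall
  have hgB (x) : g x ∉ A.image f := (mem_sdiff.1 (mem_filter.1 (hg x)).1).2
  refine ⟨fun j => if h : j ∈ A then f j else g ⟨j, h⟩, ?_, ?_, ?_⟩
  · intro j j' h
    dsimp only at h
    split_ifs at h with h1 h2 h2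
    · exact hf h1 h2 h
    · exact (hgB _ (h ▸ mem_image_of_mem f h1)).elim
    · exact (hgB _ (h ▸ mem_image_of_mem f h2)).elim
    · exact congrArg Subtype.val (ginj h)
  · intro j hj
    simp [hj]
  · intro j hj
    simpa [hj] using (mem_filter.1 (hg ⟨j, hj⟩)).2

/-- The entries `f i j` with `j ∈ A i` form a partial Latin rectangle. -/
structure IsPartialLatin {ι κ : Type*} (A : ι → Finset κ) (f : ι → κ → κ) : Prop where
  row : ∀ i, Set.InjOn (f i) (A i)
  col : ∀ i i' j, i ≠ i' → j ∈ A i → j ∈ A i' → f i j ≠ f i' j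

/-- A partial Latin rectangle whose rows have enough empty cells can be completed. -/
theorem IsPartialLatin.exists_completion {ι κ : Type*} [Fintype ι] [DecidableEq ι] [Fintype κ]
    [DecidableEq κ] {A : ι → Finset κ} {f : ι → κ → κ} (h : IsPartialLatin A f)
    (hA : ∀ i, (A i).card + 2 * (Fintype.card ι - 1) ≤ Fintype.card κ) :
    ∃ g : ι → κ → κ, (∀ i, Function.Injective (g i)) ∧ (∀ i i' j, g i j = g i' j → i = i') ∧
      ∀ i, ∀ j ∈ A i, g i j = f i j := by
  suffices H : ∀ T : Finset ι, ∃ g : ι → κ → κ,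
      IsPartialLatin (fun i => if i ∈ T then univ else A i) g ∧ ∀ i, ∀ j ∈ A i, g i j = f i j by
    obtain ⟨g, hg, hgf⟩ := H univ
    refine ⟨g, fun i j j' hj => hg.row i (by simp) (by simp) hj, fun i i' j hj => ?_, hgf⟩
    by_contra hne
    exact hg.col i i' j hne (by simp) (by simp) hj
  intro T
  induction T using Finset.induction_on with
  | empty => exact ⟨f, by simpa using h, fun _ _ _ => rfl⟩
  | insert a T ha ih =>
    obtain ⟨g, hg, hgf⟩ := ih
    set A' : ι → Finset κ := fun i => if i ∈ T then univ else A i with hA'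
    have hAa : A' a = A a := by simp [hA', ha]
    have hcard : (univ.erase a : Finset ι).card = Fintype.card ι - 1 := by
      rw [card_erase_of_mem (mem_univ _), card_univ]
    -- Forbidden are the entries of all other rows, including prescribed cells of rows not yet
    -- completed.
    obtain ⟨r, rinj, hr, hrF⟩ := exists_injective_extension (t := Fintype.card ι - 1) (A a) (g a)
      (hAa ▸ hg.row a) (fun j s => ∃ i, i ≠ a ∧ j ∈ A' i ∧ g i j = s)
      (by
        intro j
        rw [← hcard]
        refine le_trans ?_ (card_image_le (s := univ.erase a) (f := fun i => g i j))
        rw [← Set.ncard_coe_finset]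
        refine Set.ncard_le_ncard ?_ (Set.toFinite _)
        rintro s ⟨i, hi, -, rfl⟩
        simpa using ⟨i, hi, rfl⟩)
      (by
        intro s
        rw [← hcard, ← Set.ncard_coe_finset]
        have hex : ∀ j : κ, ∃ i : ι, j ∈ {j | ∃ i, i ≠ a ∧ j ∈ A' i ∧ g i j = s} →
            i ≠ a ∧ j ∈ A' i ∧ g i j = s := by
          intro j
          by_cases hj : ∃ i, i ≠ a ∧ j ∈ A' i ∧ g i j = s
          · exact ⟨hj.choose, fun _ => hj.choose_spec⟩
          · exact ⟨a, fun h' => (hj h').elim⟩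
        choose w hw using hex
        refine Set.ncard_le_ncard_of_injOn w ?_ ?_ (Set.toFinite _)
        · intro j hj
          simpa using (hw j hj).1
        · intro j hj j' hj' hww
          obtain ⟨-, h1, h2⟩ := hw j hj
          obtain ⟨-, h3, h4⟩ := hw j' hj'
          rw [← hww] at h3 h4
          exact hg.row _ h1 h3 (h2.trans h4.symm))
      (hA a)
    have hAi {i} (hi : i ≠ a) : (if i ∈ insert a T then univ else A i) = A' i := by
      simp [hA', mem_insert, hi]
    have hcol (i) (j) (hi : i ≠ a) (hj : j ∈ A' i) : g i j ≠ r j := by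
      by_cases hja : j ∈ A a
      · rw [hr j hja]
        exact hg.col i a j hi hj (by rw [hAa]; exact hja)
      · exact fun hh => hrF j hja ⟨i, hi, hj, hh⟩
    refine ⟨Function.update g a r, ⟨?_, ?_⟩, ?_⟩
    · intro i
      by_cases hi : i = a
      · subst hi
        rw [Function.update_self]
        exact rinj.injOn
      · rw [Function.update_of_ne hi]
        simp only [hAi hi]
        exact hg.row i
    · intro i i' j hne hj hj'
      by_cases hi : i = a
      · subst hi
        have hi' := hne.symm
        rw [Function.update_self, Function.update_of_ne hi']
        exact (hcol i' j hi' (by simpa only [hAi hi'] using hj')).symm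
      · replace hj : j ∈ A' i := by simpa only [hAi hi] using hj
        rw [Function.update_of_ne hi]
        by_cases hi' : i' = a
        · subst hi'
          rw [Function.update_self]
          exact hcol i j hi hj
        · rw [Function.update_of_ne hi']
          exact hg.col i i' j hne hj (by simpa only [hAi hi'] using hj')
    · intro i j hj
      by_cases hi : i = a
      · subst hi
        rw [Function.update_self, hr j hj, hgf _ j hj]
      · rw [Function.update_of_ne hi, hgf i j hj]

/-! ### Construction with `n + 1` symbols -/

/-- A Latin rectangle with last column `e (i, i)` in which, for `i ≠ k`, the column of the symbol
`e (i, i)` in row `k` carries the symbol `e (i, k)` in row `i`. -/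
theorem exists_latin_rectangle {m n : ℕ} (hm : 2 ≤ m) (hmn : m * (m + 1) ≤ n + 1)
    (e : Fin m × Fin m ↪ Fin n) :
    ∃ g : Fin m → Fin (n + 1) → Fin (n + 1), (∀ i, Function.Injective (g i)) ∧
      (∀ i i' j, g i j = g i' j → i = i') ∧ (∀ i, g i (Fin.last n) = (e (i, i)).castSucc) ∧
      ∀ i k, i ≠ k → g k (e (i, k)).castSucc = (e (i, i)).castSucc ∧
        g i (e (i, k)).castSucc = (e (i, k)).castSucc := by
  classical
  let E : Fin m × Fin m → Fin (n + 1) := fun p => (e p).castSucc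
  have hE : Function.Injective E := (Fin.castSucc_injective n).comp e.injective
  have hEl (p) : E p ≠ Fin.last n := (Fin.castSucc_lt_last _).ne
  -- Columns and symbols share one index set. The default value of `extend` supplies the last
  -- column.
  let f : Fin m → Fin (n + 1) → Fin (n + 1) := fun k =>
    Function.extend E (fun p => if p.2 = k then E (p.1, p.1) else E p) (fun _ => E (k, k))
  let A : Fin m → Finset (Fin (n + 1)) := fun k =>
    insert (Fin.last n) (((univ.erase k).image fun i => E (i, k)) ∪
      ((univ.erase k).image fun i => E (k, i)))
  have fl (k) : f k (Fin.last n) = E (k, k) :=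
    Function.extend_apply' _ _ _ fun ⟨p, hp⟩ => hEl p hp
  have f1 (k i) : f k (E (i, k)) = E (i, i) := by
    simp only [f, hE.extend_apply]; simp
  have f2 (k i) (h : i ≠ k) : f k (E (k, i)) = E (k, i) := by
    simp only [f, hE.extend_apply]; simp [h]
  have memA (k j) : j ∈ A k ↔ j = Fin.last n ∨ (∃ i, i ≠ k ∧ E (i, k) = j) ∨
      ∃ i, i ≠ k ∧ E (k, i) = j := by
    simp [A]
  have hlat : IsPartialLatin A f := by
    constructor
    · intro k j hj j' hj' h
      rw [mem_coe, memA] at hj hj'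
      rcases hj with rfl | ⟨i, hi, rfl⟩ | ⟨i, hi, rfl⟩ <;>
      rcases hj' with rfl | ⟨i', hi', rfl⟩ | ⟨i', hi', rfl⟩ <;>
      first
        | rfl
        | (simp only [f1, f2 _ _ hi, f2 _ _ hi', hE.eq_iff, Prod.mk.injEq] at h ⊢; grind)
        | (simp only [fl, f1, f2 _ _ hi, hE.eq_iff, Prod.mk.injEq] at h ⊢; grind)
        | (simp only [fl, f1, f2 _ _ hi', hE.eq_iff, Prod.mk.injEq] at h ⊢; grind)
    · intro k k' j hne hj hj' h
      rw [memA] at hj hj'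
      rcases hj with rfl | ⟨i, hi, rfl⟩ | ⟨i, hi, rfl⟩
      · simp only [fl, hE.eq_iff, Prod.mk.injEq] at h
        exact hne h.1
      · rcases hj' with hj' | ⟨i', hi', hj'⟩ | ⟨i', hi', hj'⟩
        · exact hEl _ hj'
        · rw [hE.eq_iff, Prod.mk.injEq] at hj'
          exact hne hj'.2.symm
        · rw [hE.eq_iff, Prod.mk.injEq] at hj'
          obtain ⟨rfl, rfl⟩ := hj'
          rw [f1, f2 _ _ hi', hE.eq_iff, Prod.mk.injEq] at h
          exact hi h.2
      · rcases hj' with hj' | ⟨i', hi', hj'⟩ | ⟨i', hi', hj'⟩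
        · exact hEl _ hj'
        · rw [hE.eq_iff, Prod.mk.injEq] at hj'
          obtain ⟨rfl, rfl⟩ := hj'
          rw [f1, f2 _ _ hi, hE.eq_iff, Prod.mk.injEq] at h
          exact hi h.2
        · rw [hE.eq_iff, Prod.mk.injEq] at hj'
          exact hne hj'.1.symm
  have hcard (k) : (A k).card + 2 * (Fintype.card (Fin m) - 1) ≤ Fintype.card (Fin (n + 1)) := by
    have h1 : (A k).card ≤ (m - 1) + (m - 1) + 1 := by
      refine (card_insert_le _ _).trans (Nat.add_le_add_right ((card_union_le _ _).trans ?_) 1)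
      have he : (univ.erase k : Finset (Fin m)).card = m - 1 := by
        rw [card_erase_of_mem (mem_univ _), card_univ, Fintype.card_fin]
      refine add_le_add ?_ ?_ <;> exact card_image_le.trans he.le
    simp only [Fintype.card_fin]
    obtain ⟨a, rfl⟩ := Nat.exists_eq_add_of_le hm
    have : (2 + a) * (2 + a + 1) = 6 + 5 * a + a * a := by ring
    have h2 : 4 * a + 5 ≤ n + 1 := by nlinarith
    omega
  obtain ⟨g, g1, g2, g3⟩ := hlat.exists_completion hcard
  refine ⟨g, g1, g2, fun i => ?_, fun i k hik => ⟨?_, ?_⟩⟩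
  · rw [g3 i _ ((memA _ _).2 (Or.inl rfl)), fl]
  · exact (g3 k _ ((memA _ _).2 (Or.inr (Or.inl ⟨i, hik, rfl⟩)))).trans (f1 k i)
  · exact (g3 i _ ((memA _ _).2 (Or.inr (Or.inr ⟨k, hik.symm, rfl⟩)))).trans (f2 i k hik.symm)

/-- Deleting the last column makes row `i` miss exactly `e (i, i)`. Its full cells carry symbols `e
(i, k)`, which are disjoint for different rows; non-full cells of different rows miss different
symbols. -/
theorem exists_locatingArray {m n : ℕ} (hm : 2 ≤ m) (hmn : m * (m + 1) ≤ n + 1) :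
    ∃ L : Fin m → Fin n → Fin (n + 1), LocatingArray L := by
  have hcard : Fintype.card (Fin m × Fin m) ≤ Fintype.card (Fin n) := by
    simp only [Fintype.card_prod, Fintype.card_fin]
    nlinarith
  obtain ⟨e⟩ := Function.Embedding.nonempty_of_card_le hcard
  obtain ⟨g, ginj, gcol, glast, ge⟩ := exists_latin_rectangle hm hmn e
  have he {p q} (h : (e p).castSucc = (e q).castSucc) : p = q :=
    e.injective (Fin.castSucc_injective n h)
  have miss (i s) (hs : s ≠ (e (i, i)).castSucc) : ∃ j : Fin n, g i j.castSucc = s := by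
    obtain ⟨j, hj⟩ := Finite.surjective_of_injective (ginj i) s
    refine Fin.lastCases (motive := fun j => g i j = s → _) ?_ ?_ j hj
    · intro h
      exact (hs (h ▸ glast i)).elim
    · exact fun j h => ⟨j, h⟩
  have key (i j) (h : Near (fun i (j : Fin n) => g i j.castSucc) i j (e (i, i)).castSucc) :
      ∃ k, g i j.castSucc = (e (i, k)).castSucc := by
    rcases h with ⟨j', h⟩ | ⟨k, h⟩
    · have := ginj i (h.trans (glast i).symm)
      exact ((Fin.castSucc_lt_last j').ne this).elim
    · have hik : i ≠ k := by
        rintro rfl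
        have := ginj i (h.trans (glast i).symm)
        exact (Fin.castSucc_lt_last j).ne this
      have hj := ginj k (h.trans (ge i k hik).1.symm)
      exact ⟨k, hj ▸ (ge i k hik).2⟩
  refine ⟨fun i j => g i j.castSucc, ?_, ?_, ?_, ?_⟩
  · exact fun i => (ginj i).comp (Fin.castSucc_injective n)
  · exact fun i i' j h => gcol i i' _ h
  · intro s
    by_cases hs : s = (e (⟨0, by omega⟩, ⟨0, by omega⟩)).castSucc
    · refine ⟨⟨1, by omega⟩, miss _ _ fun h => ?_⟩
      simpa using he (hs.symm.trans h)
    · exact ⟨⟨0, by omega⟩, miss _ _ hs⟩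
  · intro i i' j j' hne h hn
    have n1 := (hn (e (i, i)).castSucc).2 (Or.inl (miss i' _ fun h' => hne (by simpa using he h')))
    have n2 := (hn (e (i', i')).castSucc).1
      (Or.inl (miss i _ fun h' => hne (by simpa using (he h').symm)))
    obtain ⟨k, hk⟩ := key i j n1
    obtain ⟨k', hk'⟩ := key i' j' n2
    exact hne (congrArg Prod.fst (he (hk.symm.trans (h.trans hk'))))

theorem locatingChromaticNumber_eq {V : Type*} {G : SimpleGraph V} {k : ℕ}
    (h : ∃ c : G.Coloring (Fin k), IsLocating c)
    (hle : ∀ l, (∃ c : G.Coloring (Fin l), IsLocating c) → k ≤ l) :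
    locatingChromaticNumber G = k :=
  le_antisymm (iInf₂_le k h) (le_iInf₂ fun l hl => by exact_mod_cast hle l hl)

end LocatingColoring

theorem theorem3 (m n m₀ : ℕ) (hm : 2 ≤ m) (hn : 3 ≤ n) (hmn : m ≤ n)
    (hm₀ : IsGreatest {k : ℕ | (k : ℤ) * ((k : ℤ) - 1) - 1 ≤ (n : ℤ)} m₀) :
    (m + 1 ≤ m₀ →
      LocatingColoring.locatingChromaticNumber
        (SimpleGraph.boxProd (SimpleGraph.completeGraph (Fin m)) (SimpleGraph.completeGraph (Fin n))) = ((n + 1 : ℕ) : ℕ∞)) ∧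
    (m₀ + 1 ≤ m → (m : ℚ) ≤ (n : ℚ) / 2 →
      LocatingColoring.locatingChromaticNumber
        (SimpleGraph.boxProd (SimpleGraph.completeGraph (Fin m)) (SimpleGraph.completeGraph (Fin n))) = ((n + 2 : ℕ) : ℕ∞)) := by
  open LocatingColoring in
  constructor
  · intro h
    refine locatingChromaticNumber_eq (exists_isLocating_iff.2 (exists_locatingArray hm ?_)) ?_
    · have h0 : (m₀ : ℤ) * ((m₀ : ℤ) - 1) - 1 ≤ (n : ℤ) := hm₀.1
      have h1 : (m : ℤ) + 1 ≤ m₀ := by exact_mod_cast h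
      have h2 : (m : ℤ) * (m + 1) ≤ n + 1 := by nlinarith
      exact_mod_cast h2
    · intro l hl
      obtain ⟨L, hL⟩ := exists_isLocating_iff.1 hl
      exact hL.lt_card hm (by omega)
  · intro h hq
    have h2 : 2 * m ≤ n := by
      have : (2 : ℚ) * m ≤ n := by linarith
      exact_mod_cast this
    refine locatingChromaticNumber_eq
      (exists_isLocating_iff.2 ⟨_, locatingArray_cyclicArray hm h2⟩) fun l hl => ?_
    obtain ⟨L, hL⟩ := exists_isLocating_iff.1 hl
    rcases (hL.lt_card hm (by omega)).eq_or_lt with rfl | hlt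
    · exfalso
      have h3 := hL.mul_pred_le h2 (by omega)
      have h4 : m ≤ m₀ := hm₀.2 (by
        have h5 : ((m * (m - 1) : ℕ) : ℤ) ≤ ((n + 1 : ℕ) : ℤ) := by exact_mod_cast h3
        rw [Nat.cast_mul, Nat.cast_sub (by omega)] at h5
        push_cast at h5
        simp only [Set.mem_ofPred_eq]
        linarith)
      omega
    · exact hlt
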